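/- For a real number $x$, an integer $q\ge 1$ and an integer $a$, let $\pi(x)$ be the number of primes $p\le x$ and $\pi(x;q,a)$ the number of primes $p\le x$ with $p\equiv a\pmod q$. The Friedlander--Granville--Montgomery conjecture asserts that for every $\varepsilon'>0$ there is a constant $C_{\varepsilon'}$ such that \[ \Big|\pi(x;q,a)-\frac{\pi(x)}{\varphi(q)}\Big|\le C_{\varepsilon'}\,(x/q)^{1/2}\,x^{\varepsilon'}\qquad\text{for all } 1\le q<x \text{ and all } a \text{ with } (a,q)=1. \] For real $x$ and an integer $q\geq 1$ consider the following algorithm. First pick $a$ uniformly at random among the invertible classes modulo $q$, represented by integers in $\{0,\dots,q-1\}$. Then repeat the following main loop forever: pick $t$ uniformly at random in $\{0,\dots,\lfloor (x-a)/q\rfloor\}$, independently of the values of $t$ picked before, set $p=a+tq$, and, if $p$ is prime, return $p$ and stop. A uniform random draw from a set of $N$ elements is counted as $\log_2 N$ random bits; the draw of $a$ is counted too. Assume the Friedlander--Granville--Montgomery conjecture. Let $0<\varepsilon<1$, and for each real $x$ let $q=q(x)\ge 1$ be an integer such that $q(x)\asymp x^{1-\varepsilon}$ as $x\to+\infty$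 (that is, $c\,x^{1-\varepsilon}\le q(x)\le C\,x^{1-\varepsilon}$ for some constants $c,C>0$ and all sufficiently large $x$). Then: 1. for all sufficiently large $x$, the algorithm run with parameters $x$ and $q=q(x)$ terminates almost surely; 2. as $x\to+\infty$, its expected number of iterations of the main loop is $(1+o(1))\,\dfrac{\varphi(q)}{q}\,\log x$; 3. as $x\to+\infty$, the expected number of random bits that it consumes is $(\varepsilon+o(1))\,\dfrac{\varphi(q)}{q}\cdot\dfrac{(\log x)^2}{\log 2}$. -/

import Mathlib

open Filter Topology Asymptotics MeasureTheory ProbabilityTheory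
open scoped ENNReal

namespace PrimeGen

/-- `π(x; q, a)`: the number of primes `p ≤ x` with `p ≡ a (mod q)`. -/
noncomputable def primeCountingAP (x : ℝ) (q a : ℕ) : ℕ :=
  ((Finset.range (⌊x⌋₊ + 1)).filter fun p => p.Prime ∧ p ≡ a [MOD q]).card

/-- The Friedlander--Granville--Montgomery conjecture: for every `ε > 0`,
`|π(x; q, a) - π(x) / φ(q)| ≪_ε (x / q) ^ (1 / 2) * x ^ ε` for all `q < x` and `(a, q) = 1`. -/
def FriedlanderGranvilleMontgomery : Prop :=
  ∀ ε : ℝ, 0 < ε → ∃ C : ℝ, ∀ (x : ℝ) (q a : ℕ), 0 < q → (q : ℝ) < x → a.Coprime q →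
    |(primeCountingAP x q a : ℝ) - (Nat.primeCounting ⌊x⌋₊ : ℝ) / (Nat.totient q : ℝ)|
      ≤ C * (x / q) ^ (1 / 2 : ℝ) * x ^ ε

/-- The invertible classes modulo `q`, as integers in `{0, …, q - 1}` prime to `q`
(hence in `{1, …, q - 1}` as soon as `q ≥ 2`). -/
def unitReps (q : ℕ+) : Finset ℕ :=
  (Finset.range q).filter fun a => (q : ℕ).Coprime a

theorem unitReps_nonempty (q : ℕ+) : (unitReps q).Nonempty :=
  Finset.card_pos.mp (Nat.totient_pos.mpr q.pos)

/-- The set `{0, …, ⌊(x - a) / q⌋}` from which `t` is drawn. (For `a > x`, where the set of the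
algorithm is empty, this is `{0}`; it does not occur when `q ≤ x`.) -/
noncomputable def tRange (x : ℝ) (q : ℕ+) (a : ℕ) : Finset ℕ :=
  Finset.range (⌊(x - a) / (q : ℕ)⌋₊ + 1)

theorem tRange_nonempty (x : ℝ) (q : ℕ+) (a : ℕ) : (tRange x q a).Nonempty :=
  Finset.nonempty_range_iff.mpr (Nat.succ_ne_zero _)

/-- The random choices available to one run of the algorithm: the residue `a`, and the
sequence `t 0, t 1, …` of the values drawn in the successive iterations of the main loop. -/
abbrev Run : Type := ℕ × (ℕ → ℕ)

/-- The uniform distribution of `a` over the invertible classes modulo `q`. -/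
noncomputable def residueLaw (q : ℕ+) : Measure ℕ :=
  (PMF.uniformOfFinset (unitReps q) (unitReps_nonempty q)).toMeasure

/-- Given `a`, the values drawn in the main loop are independent and uniform on
`{0, …, ⌊(x - a) / q⌋}`. -/
noncomputable def loopLaw (x : ℝ) (q : ℕ+) : Kernel ℕ (ℕ → ℕ) :=
  Kernel.ofFunOfCountable fun a => Measure.infinitePi fun _ : ℕ =>
    (PMF.uniformOfFinset (tRange x q a) (tRange_nonempty x q a)).toMeasure

/-- The joint law of all random choices: first `a`, and then, given `a`, the values of `t`. -/
noncomputable def runLaw (x : ℝ) (q : ℕ+) : Measure Run :=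
  residueLaw q ⊗ₘ loopLaw x q

instance (q : ℕ+) : IsProbabilityMeasure (residueLaw q) := by
  unfold residueLaw; infer_instance

instance (x : ℝ) (q : ℕ+) : IsMarkovKernel (loopLaw x q) :=
  ⟨fun a => by
    change IsProbabilityMeasure (Measure.infinitePi fun _ : ℕ =>
      (PMF.uniformOfFinset (tRange x q a) (tRange_nonempty x q a)).toMeasure)
    infer_instance⟩

instance (x : ℝ) (q : ℕ+) : IsProbabilityMeasure (runLaw x q) := by
  unfold runLaw; infer_instance

/-- The number `p = a + t * q` tested in iteration `k + 1` of the main loop. -/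
def candidate (q : ℕ+) (ω : Run) (k : ℕ) : ℕ := ω.1 + ω.2 k * q

/-- The run terminates: some iteration finds a prime, which is then returned. -/
def Terminates (q : ℕ+) (ω : Run) : Prop := ∃ k, (candidate q ω k).Prime

/-- The number of iterations of the main loop, i.e. the (1-based) index of the first iteration
that finds a prime; it is `⊤` if the loop runs forever. -/
noncomputable def iterations (q : ℕ+) (ω : Run) : ℕ∞ :=
  ⨅ (k : ℕ) (_ : (candidate q ω k).Prime), ((k + 1 : ℕ) : ℕ∞)

/-- A uniform draw from a set `S` consumes `log₂ |S|` random bits. -/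
noncomputable def drawBits (S : Finset ℕ) : ℝ≥0∞ := ENNReal.ofReal (Real.logb 2 S.card)

/-- The number of random bits consumed by a run: one draw of `a`, and one draw of `t` in each
iteration of the main loop. -/
noncomputable def randomBits (x : ℝ) (q : ℕ+) (ω : Run) : ℝ≥0∞ :=
  drawBits (unitReps q) + (iterations q ω : ℝ≥0∞) * drawBits (tRange x q ω.1)

end PrimeGen

/-! The prime number theorem is obtained by a Wiener–Ikehara argument with the Fejér kernel; together with the
Friedlander–Granville–Montgomery conjecture it gives the expected cost of the prime generator. -/

/-! Fix the residue `a`. Each iteration succeeds with probability `π(x; q, a) / N`, where `N = ⌊(x -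
a) / q⌋ + 1`, so the number of iterations is geometric with mean `N / π(x; q, a)`. Here `N ~ x / q`.
Since `x / q ≍ x ^ ε`, the conjecture with exponent `ε / 4` has a relative error of order `x ^ (-ε /
4) * log x`, so with the prime number theorem `π(x; q, a) ~ x / (φ(q) log x)`, and the mean is `~
(φ(q) / q) log x`. Each `t` costs `log₂ N ~ ε log₂ x` bits. The draw of `a` costs at most `log₂ x`
bits, which is negligible because `(φ(q) / q) log x → ∞`. All this is uniform in `a`
(`eventually_forall_mem_of_forall_selector`), hence survives averaging over `a`; a finite mean
forces almost sure termination.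

The prime number theorem comes from `tendsto_one_of_laplace` applied to `H u = ψ(e^u) e^(-u)`. The
Laplace transform of `H - 1` extends continuously to the closed half-plane, so by Riemann–Lebesgue
the Fejér averages of `H - 1` tend to `0`; monotonicity of `ψ` keeps `H` from dropping quickly,
which allows the averages to be replaced by values of `H`. The divergence of `(φ(q) / q) log x`
comes from an elementary bound, `one_le_totient_div_sq_mul`. -/

/-! ### The Fejér kernel. -/

/-- The Fejér kernel, whose Fourier transform is a triangle function. -/
noncomputable def fejerKernel (v : ℝ) : ℝ := Real.sinc (v / 2) ^ 2

theorem fejerKernel_nonneg (v : ℝ) : 0 ≤ fejerKernel v := sq_nonneg _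

theorem continuous_fejerKernel : Continuous fejerKernel :=
  (Real.continuous_sinc.comp (continuous_id.div_const 2)).pow 2

theorem fejerKernel_le_one (v : ℝ) : fejerKernel v ≤ 1 :=
  (sq_le_one_iff_abs_le_one _).2 (abs_le.2 ⟨Real.neg_one_le_sinc _, Real.sinc_le_one _⟩)

theorem fejerKernel_eq {v : ℝ} (hv : v ≠ 0) : fejerKernel v = 2 * (1 - Real.cos v) / v ^ 2 := by
  have hcos : Real.cos v = 1 - 2 * Real.sin (v / 2) ^ 2 := by
    rw [← Real.cos_sq_add_sin_sq (v / 2)]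
    conv_lhs => rw [show v = 2 * (v / 2) by ring, Real.cos_two_mul']
    ring
  rw [fejerKernel, Real.sinc_of_ne_zero (by simpa using hv), hcos]
  field_simp
  ring

-- The constant is `5 = 1 + 4`: the kernel is at most `1`, and `v ^ 2` times it is `2 * (1 - cos v)
-- ≤ 4`.
theorem fejerKernel_le_inv (v : ℝ) : fejerKernel v ≤ 5 * (1 + v ^ 2)⁻¹ := by
  rw [← div_eq_mul_inv, le_div_iff₀ (by positivity)]
  have h1 := fejerKernel_le_one v
  have h2 : fejerKernel v * v ^ 2 ≤ 4 := by
    rcases eq_or_ne v 0 with rfl | hv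
    · norm_num
    · rw [fejerKernel_eq hv, div_mul_cancel₀ _ (by positivity)]
      linarith [Real.neg_one_le_cos v]
  linarith

theorem integrable_fejerKernel : Integrable fejerKernel := by
  refine (integrable_inv_one_add_sq.const_mul 5).mono'
    continuous_fejerKernel.aestronglyMeasurable (ae_of_all _ fun v => ?_)
  rw [Real.norm_of_nonneg (fejerKernel_nonneg v)]
  exact fejerKernel_le_inv v

theorem integral_fejerKernel_pos : 0 < ∫ v, fejerKernel v := by
  refine (integral_pos_iff_support_of_nonneg fejerKernel_nonneg integrable_fejerKernel).2 ?_
  refine (continuous_fejerKernel.isOpen_support).measure_pos _ ⟨0, ?_⟩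
  simp [fejerKernel]

theorem integral_triangle_mul_cos (v : ℝ) :
    ∫ t in (0 : ℝ)..1, 2 * (1 - t) * Real.cos (t * v) = fejerKernel v := by
  rcases eq_or_ne v 0 with rfl | hv
  · have h : ∫ t in (0 : ℝ)..1, (2 - 2 * t) = 1 := by
      rw [intervalIntegral.integral_sub (by simp)
        (Continuous.intervalIntegrable (by fun_prop) _ _), intervalIntegral.integral_const_mul,
        integral_id]
      norm_num
    simp only [mul_zero, Real.cos_zero, mul_one, fejerKernel, zero_div, Real.sinc_zero, one_pow]
    rw [intervalIntegral.integral_congr fun t _ => (by ring : 2 * (1 - t) = 2 - 2 * t), h]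
  · rw [fejerKernel_eq hv]
    have h (t : ℝ) : HasDerivAt (fun t : ℝ => 2 * (1 - t) * Real.sin (t * v) / v
        - 2 * Real.cos (t * v) / v ^ 2) (2 * (1 - t) * Real.cos (t * v)) t := by
      have hl : HasDerivAt (fun t : ℝ => t * v) v t := by simpa using (hasDerivAt_id t).mul_const v
      have h1 : HasDerivAt (fun t : ℝ => 2 * (1 - t)) (-2) t := by
        simpa using ((hasDerivAt_id t).const_sub 1).const_mul 2
      convert! ((h1.mul hl.sin).div_const v).sub ((hl.cos.const_mul 2).div_const (v ^ 2)) using 1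
      field_simp
      ring
    rw [intervalIntegral.integral_eq_sub_of_hasDerivAt (fun t _ => h t)
      (Continuous.intervalIntegrable (by fun_prop) _ _)]
    simp
    field_simp
    ring

/-! ### Fejér averages of a bounded function and its Laplace transform. -/

section Tauberian

variable {g : ℝ → ℝ} {M : ℝ} {F : ℂ → ℂ}

/-- Fubini, after writing the kernel as the cosine integral of the triangle function. The damping
`exp (-σ * u)` gives absolute convergence and places the argument of `F` inside the half-plane;
cosine appears as a real part, so only `t ∈ [0, 1]` is needed. -/
theorem integral_mul_fejerKernel_eq (hg : Measurable g) (hM : ∀ u, |g u| ≤ M)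
    (hF : ∀ z : ℂ, 0 < z.re → ∫ u in Set.Ioi (0 : ℝ), (g u : ℂ) * Complex.exp (-z * u) = F z)
    (l y : ℝ) {σ : ℝ} (hσ : 0 < σ) :
    ∫ u in Set.Ioi (0 : ℝ), g u * Real.exp (-σ * u) * fejerKernel (l * (y - u)) =
      (∫ t in (0 : ℝ)..1, (2 * (1 - t) : ℝ) * Complex.exp ((l * t * y : ℝ) * Complex.I) *
        F (σ + (l * t : ℝ) * Complex.I)).re := by
  set f : ℝ → ℝ → ℂ := fun t u => (2 * (1 - t) : ℝ) * Complex.exp ((t * (l * (y - u)) : ℝ) * Complex.I)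
    * (g u * Real.exp (-σ * u) : ℝ) with hf
  have hdom : Integrable (fun u : ℝ => M * Real.exp (-σ * u)) (volume.restrict (Set.Ioi 0)) :=
    (integrableOn_exp_mul_Ioi (by linarith) 0).const_mul M
  have hint : Integrable (Function.uncurry f)
      ((volume.restrict (Set.Ioc 0 1)).prod (volume.restrict (Set.Ioi (0 : ℝ)))) := by
    have hb : Integrable (fun p : ℝ × ℝ => (2 : ℝ) * (M * Real.exp (-σ * p.2)))
        ((volume.restrict (Set.Ioc 0 1)).prod (volume.restrict (Set.Ioi (0 : ℝ)))) :=
      Integrable.mul_prod (f := fun _ : ℝ => (2 : ℝ)) (integrable_const _) hdom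
    refine hb.mono' ?_ ?_
    · refine Measurable.aestronglyMeasurable ?_
      simp only [hf, Function.uncurry_def]
      fun_prop
    · rw [Measure.prod_restrict]
      filter_upwards [ae_restrict_mem (measurableSet_Ioc.prod measurableSet_Ioi)] with p hp
      obtain ⟨⟨hp0, hp1⟩, -⟩ := hp
      simp only [hf, Function.uncurry_def, norm_mul, Complex.norm_exp_ofReal_mul_I, mul_one,
        Complex.norm_real, Real.norm_eq_abs, Real.abs_exp, Nat.abs_ofNat]
      have h1 : |1 - p.1| ≤ 1 := abs_le.2 ⟨by linarith, by linarith⟩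
      have := hM p.2
      gcongr
      linarith
  have hre : ∀ u, ∫ t in Set.Ioc (0 : ℝ) 1, f t u =
      ((∫ t in Set.Ioc (0 : ℝ) 1, (2 * (1 - t) : ℝ) * Complex.exp ((t * (l * (y - u)) : ℝ) * Complex.I))
        * (g u * Real.exp (-σ * u) : ℝ)) := fun u => by
    rw [← integral_mul_const]
  have hswap := integral_integral_swap hint
  have hleft : ∀ t, ∫ u in Set.Ioi (0 : ℝ), f t u =
      (2 * (1 - t) : ℝ) * Complex.exp ((l * t * y : ℝ) * Complex.I) *
        F (σ + (l * t : ℝ) * Complex.I) := fun t => by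
    rw [← hF _ (by simpa using hσ), ← integral_const_mul]
    congr 1 with u
    simp only [hf]
    push_cast
    have h : Complex.exp (t * (l * (y - u)) * Complex.I) * Complex.exp (-σ * u) =
        Complex.exp (l * t * y * Complex.I) * Complex.exp (-(σ + l * t * Complex.I) * u) := by
      rw [← Complex.exp_add, ← Complex.exp_add]
      ring_nf
    linear_combination 2 * (1 - (t : ℂ)) * g u * h
  rw [intervalIntegral.integral_of_le zero_le_one]
  simp only [hleft] at hswap
  have hint' : Integrable (fun u => ∫ t in Set.Ioc (0 : ℝ) 1, f t u)
      (volume.restrict (Set.Ioi (0 : ℝ))) := hint.integral_prod_right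
  rw [hswap, ← RCLike.re_eq_complex_re, ← integral_re hint']
  congr 1 with u
  rw [hre, RCLike.re_eq_complex_re, Complex.re_mul_ofReal, mul_comm, ← RCLike.re_eq_complex_re,
    ← integral_re]
  · rw [← integral_triangle_mul_cos, intervalIntegral.integral_of_le zero_le_one]
    congr 2 with t
    rw [RCLike.re_eq_complex_re, Complex.re_ofReal_mul, Complex.exp_ofReal_mul_I_re]
  · refine Continuous.integrableOn_Ioc (by fun_prop)

/-- Let `σ → 0+` in the damped identity. The left side is dominated by `M` times the integrable
kernel, the right side by the bound of the continuous `F` on a compact rectangle. -/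
theorem integral_mul_fejerKernel_eq_boundary (hg : Measurable g) (hM : ∀ u, |g u| ≤ M)
    (hFc : ContinuousOn F {z | 0 ≤ z.re})
    (hF : ∀ z : ℂ, 0 < z.re → ∫ u in Set.Ioi (0 : ℝ), (g u : ℂ) * Complex.exp (-z * u) = F z)
    {l : ℝ} (hl : 0 < l) (y : ℝ) :
    ∫ u in Set.Ioi (0 : ℝ), g u * fejerKernel (l * (y - u)) =
      (∫ t in (0 : ℝ)..1, (2 * (1 - t) : ℝ) * Complex.exp ((l * t * y : ℝ) * Complex.I) *
        F ((l * t : ℝ) * Complex.I)).re := by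
  have hK : Integrable (fun u => fejerKernel (l * (y - u))) :=
    (integrable_fejerKernel.comp_mul_left' hl.ne').comp_sub_left y
  have h1 : Tendsto (fun σ : ℝ => ∫ u in Set.Ioi (0 : ℝ), g u * Real.exp (-σ * u) *
      fejerKernel (l * (y - u))) (𝓝[>] 0)
      (𝓝 (∫ u in Set.Ioi (0 : ℝ), g u * fejerKernel (l * (y - u)))) := by
    refine tendsto_integral_filter_of_dominated_convergence
      (fun u => M * fejerKernel (l * (y - u))) (Eventually.of_forall fun σ => ?_) ?_
      (hK.integrableOn.const_mul M) (ae_of_all _ fun u => ?_)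
    · have := continuous_fejerKernel
      refine Measurable.aestronglyMeasurable ?_
      fun_prop
    · filter_upwards [self_mem_nhdsWithin] with σ (hσ : 0 < σ)
      filter_upwards [ae_restrict_mem measurableSet_Ioi] with u (hu : 0 < u)
      have h2 : Real.exp (-σ * u) ≤ 1 := Real.exp_le_one_iff.2 (by nlinarith)
      rw [norm_mul, norm_mul, Real.norm_of_nonneg (fejerKernel_nonneg _),
        Real.norm_of_nonneg (Real.exp_pos _).le, Real.norm_eq_abs]
      refine mul_le_mul_of_nonneg_right ?_ (fejerKernel_nonneg _)
      calc |g u| * Real.exp (-σ * u) ≤ |g u| * 1 := by gcongr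
        _ ≤ M := by simpa using hM u
    · refine Tendsto.mul_const _ ?_
      have : Continuous fun σ : ℝ => g u * Real.exp (-σ * u) := by fun_prop
      simpa using (this.tendsto 0).mono_left nhdsWithin_le_nhds
  have hcomp : IsCompact (Set.Icc (0 : ℝ) 1 ×ℂ Set.Icc (-l) l) := isCompact_Icc.reProdIm isCompact_Icc
  obtain ⟨B, hB⟩ := hcomp.exists_bound_of_continuousOn
    (hFc.mono fun z hz => (Complex.mem_reProdIm.1 hz).1.1)
  have hmem : ∀ σ ∈ Set.Icc (0 : ℝ) 1, ∀ t ∈ Set.Ioc (0 : ℝ) 1,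
      ((σ : ℂ) + (l * t : ℝ) * Complex.I) ∈ Set.Icc (0 : ℝ) 1 ×ℂ Set.Icc (-l) l := by
    intro σ hσ t ht
    rw [Complex.mem_reProdIm]
    simp only [Complex.add_re, Complex.ofReal_re, Complex.re_ofReal_mul, Complex.I_re, mul_zero,
      add_zero, Complex.add_im, Complex.ofReal_im, Complex.im_ofReal_mul, Complex.I_im, mul_one,
      zero_add]
    refine ⟨hσ, ?_, ?_⟩ <;> nlinarith [ht.1, ht.2]
  have h2 : Tendsto (fun σ : ℝ => (∫ t in (0 : ℝ)..1, (2 * (1 - t) : ℝ) *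
      Complex.exp ((l * t * y : ℝ) * Complex.I) * F (σ + (l * t : ℝ) * Complex.I))) (𝓝[>] 0)
      (𝓝 (∫ t in (0 : ℝ)..1, (2 * (1 - t) : ℝ) *
      Complex.exp ((l * t * y : ℝ) * Complex.I) * F ((l * t : ℝ) * Complex.I))) := by
    have hI : ∀ᶠ σ : ℝ in 𝓝[>] 0, σ ∈ Set.Icc (0 : ℝ) 1 := by
      filter_upwards [Ioc_mem_nhdsGT zero_lt_one] with σ hσ using ⟨hσ.1.le, hσ.2⟩
    refine intervalIntegral.tendsto_integral_filter_of_dominated_convergence (fun _ => 2 * B) ?_ ?_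
      (by simp) (ae_of_all _ fun t ht => ?_)
    · filter_upwards [hI] with σ hσ
      rw [Set.uIoc_of_le zero_le_one]
      refine ContinuousOn.aestronglyMeasurable ?_ measurableSet_Ioc
      refine ContinuousOn.mul (by fun_prop) (hFc.comp (by fun_prop) fun t ht => ?_)
      exact (Complex.mem_reProdIm.1 (hmem σ hσ t ht)).1.1
    · filter_upwards [hI] with σ hσ
      refine ae_of_all _ fun t ht => ?_
      rw [Set.uIoc_of_le zero_le_one] at ht
      have h3 := hB _ (hmem σ hσ t ht)
      rw [norm_mul, norm_mul, Complex.norm_exp_ofReal_mul_I, mul_one, Complex.norm_real,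
        Real.norm_of_nonneg (by linarith [ht.2])]
      have := norm_nonneg (F (σ + (l * t : ℝ) * Complex.I))
      nlinarith [ht.1, ht.2]
    · rw [Set.uIoc_of_le zero_le_one] at ht
      refine Tendsto.const_mul _ ?_
      have h4 : ContinuousWithinAt F {z | 0 ≤ z.re} ((l * t : ℝ) * Complex.I) :=
        hFc _ (by simp)
      refine h4.tendsto.comp (tendsto_nhdsWithin_iff.2 ⟨?_, ?_⟩)
      · have : Continuous fun σ : ℝ => (σ : ℂ) + (l * t : ℝ) * Complex.I := by fun_prop
        simpa using (this.tendsto 0).mono_left nhdsWithin_le_nhds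
      · filter_upwards [self_mem_nhdsWithin] with σ (hσ : 0 < σ)
        simpa using hσ.le
  refine tendsto_nhds_unique h1 (((Complex.continuous_re.tendsto _).comp h2).congr' ?_)
  filter_upwards [self_mem_nhdsWithin] with σ (hσ : 0 < σ)
  exact (integral_mul_fejerKernel_eq hg hM hF l y hσ).symm

/-- On the boundary line the average is a Fourier integral over `[0, 1]` with frequency proportional
to `y`, so the Riemann–Lebesgue lemma applies. -/
theorem tendsto_integral_mul_fejerKernel (hg : Measurable g) (hM : ∀ u, |g u| ≤ M)
    (hFc : ContinuousOn F {z | 0 ≤ z.re})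
    (hF : ∀ z : ℂ, 0 < z.re → ∫ u in Set.Ioi (0 : ℝ), (g u : ℂ) * Complex.exp (-z * u) = F z)
    {l : ℝ} (hl : 0 < l) :
    Tendsto (fun y => ∫ u in Set.Ioi (0 : ℝ), g u * fejerKernel (l * (y - u))) atTop (𝓝 0) := by
  simp_rw [integral_mul_fejerKernel_eq_boundary hg hM hFc hF hl]
  have hRL := Real.tendsto_integral_exp_smul_cocompact
    ((Set.Ioc (0 : ℝ) 1).indicator fun t : ℝ => ((2 * (1 - t) : ℝ) : ℂ) * F ((l * t : ℝ) * Complex.I))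
  -- The factor `-1 / (2π)` converts `exp (i l t y)` to the normalisation `exp (-2π i t w)` of the
  -- Fourier transform.
  have hw : Tendsto (fun y : ℝ => -(l / (2 * Real.pi)) * y) atTop (cocompact ℝ) := by
    refine Tendsto.mono_right ?_ atBot_le_cocompact
    exact tendsto_id.const_mul_atTop_of_neg (by have := Real.pi_pos; simp; positivity)
  have h := (Complex.continuous_re.tendsto _).comp (hRL.comp hw)
  rw [Complex.zero_re] at h
  refine h.congr fun y => ?_
  simp only [Function.comp_apply]
  rw [intervalIntegral.integral_of_le zero_le_one, ← integral_indicator measurableSet_Ioc]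
  congr 2 with t
  simp only [Set.indicator]
  split_ifs
  · rw [Circle.smul_def, Real.fourierChar_apply, smul_eq_mul]
    have : 2 * Real.pi * -(t * (-(l / (2 * Real.pi)) * y)) = l * t * y := by
      field_simp [Real.pi_ne_zero]
    rw [this]
    ring
  · simp

end Tauberian

theorem integral_fejerKernel_comp {l : ℝ} (hl : 0 < l) (y : ℝ) :
    ∫ u, fejerKernel (l * (y - u)) = l⁻¹ * ∫ v, fejerKernel v := by
  rw [integral_sub_left_eq_self (fun v => fejerKernel (l * v)) volume y,
    Measure.integral_comp_mul_left, abs_of_pos (inv_pos.2 hl), smul_eq_mul]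

theorem integrable_fejerKernel_comp {l : ℝ} (hl : 0 < l) (y : ℝ) :
    Integrable fun u => fejerKernel (l * (y - u)) :=
  (integrable_fejerKernel.comp_mul_left' hl.ne').comp_sub_left y

theorem tendsto_integral_Ioi_fejerKernel {l : ℝ} (hl : 0 < l) :
    Tendsto (fun y => ∫ u in Set.Ioi (0 : ℝ), fejerKernel (l * (y - u))) atTop
      (𝓝 (l⁻¹ * ∫ v, fejerKernel v)) := by
  have h : ∀ y : ℝ, ∫ u in Set.Ioi (0 : ℝ), fejerKernel (l * (y - u)) =
      ∫ v, (Set.Iio y).indicator (fun v => fejerKernel (l * v)) v := fun y => by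
    rw [← integral_indicator measurableSet_Ioi, ← integral_sub_left_eq_self _ volume y]
    congr 1 with u
    simp [Set.indicator]
  have hK := integrable_fejerKernel.comp_mul_left' hl.ne'
  rw [← integral_fejerKernel_comp hl 0, integral_sub_left_eq_self (fun v => fejerKernel (l * v))]
  simp_rw [h]
  refine tendsto_integral_filter_of_dominated_convergence (fun v => fejerKernel (l * v))
    (Eventually.of_forall fun y => (hK.indicator measurableSet_Iio).aestronglyMeasurable)
    (Eventually.of_forall fun y => ae_of_all _ fun v => ?_) hK (ae_of_all _ fun v => ?_)
  · refine (norm_indicator_le_norm_self _ _).trans ?_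
    rw [Real.norm_of_nonneg (fejerKernel_nonneg _)]
  · refine tendsto_const_nhds.congr' ?_
    filter_upwards [eventually_gt_atTop v] with y hy
    simp [Set.indicator, hy]

/-! ### The Tauberian theorem: from averages to pointwise values. -/

section Tauberian

variable {H : ℝ → ℝ} {M : ℝ} {F : ℂ → ℂ}

theorem intervalIntegral_fejerKernel_comp {l : ℝ} (hl : 0 < l) (y h : ℝ) :
    ∫ u in (y - h)..(y + h), fejerKernel (l * (y - u)) =
      l⁻¹ * ∫ v in (-(l * h))..(l * h), fejerKernel v := by
  rw [intervalIntegral.integral_comp_sub_left (fun v => fejerKernel (l * v)),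
    intervalIntegral.integral_comp_mul_left _ hl.ne', smul_eq_mul]
  congr 2 <;> ring

theorem setIntegral_fejerKernel_comp {l h : ℝ} (hl : 0 < l) (hh : 0 < h) (y : ℝ) :
    ∫ u in Set.Ioc (y - h) (y + h), fejerKernel (l * (y - u)) =
      l⁻¹ * ∫ v in (-(l * h))..(l * h), fejerKernel v := by
  rw [← intervalIntegral_fejerKernel_comp hl y, intervalIntegral.integral_of_le (by linarith)]

/-- A slowly decreasing bounded function `H` whose Laplace transform, minus that of `1`, extends
continuously to the closed half-plane tends to `1`. -/
theorem tendsto_one_of_laplace (hH : Measurable H) (hH0 : ∀ u, 0 ≤ H u) (hHM : ∀ u, H u ≤ M)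
    (hslow : ∀ u h, 0 ≤ h → H u ≤ Real.exp h * H (u + h))
    (hFc : ContinuousOn F {z | 0 ≤ z.re})
    (hF : ∀ z : ℂ, 0 < z.re →
      ∫ u in Set.Ioi (0 : ℝ), ((H u - 1 : ℝ) : ℂ) * Complex.exp (-z * u) = F z) :
    Tendsto H atTop (𝓝 1) := by
  set c := ∫ v, fejerKernel v with hc
  have hc0 : 0 < c := integral_fejerKernel_pos
  have hM0 : 0 ≤ M := (hH0 0).trans (hHM 0)
  have hint : ∀ {l : ℝ}, 0 < l → ∀ y, Integrable (fun u => H u * fejerKernel (l * (y - u))) := by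
    intro l hl y
    refine (integrable_fejerKernel_comp hl y).bdd_mul (c := M) hH.aestronglyMeasurable
      (ae_of_all _ fun u => ?_)
    rw [Real.norm_of_nonneg (hH0 u)]
    exact hHM u
  have hlim : ∀ {l : ℝ}, 0 < l → Tendsto (fun y => ∫ u in Set.Ioi (0 : ℝ),
      H u * fejerKernel (l * (y - u))) atTop (𝓝 (l⁻¹ * c)) := by
    intro l hl
    have h1 := tendsto_integral_mul_fejerKernel (g := fun u => H u - 1) (M := M + 1)
      (hH.sub_const 1) (fun u => abs_le.2 ⟨by linarith [hH0 u], by linarith [hHM u]⟩) hFc hF hl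
    have h2 := h1.add (tendsto_integral_Ioi_fejerKernel hl)
    rw [zero_add] at h2
    refine h2.congr fun y => ?_
    have h3 := (integrable_fejerKernel_comp hl y).integrableOn (s := Set.Ioi 0)
    simp_rw [sub_mul, one_mul]
    rw [integral_sub (hint hl y).integrableOn h3, sub_add_cancel]
  -- Both bounds compare `H y` with an average over a window of length `2η` having `y` as an
  -- endpoint. Slow decrease costs a factor `exp (2 * η)` on the window, and `l` is taken so large
  -- that the window carries a share greater than `1 - η` of the kernel's mass.
  have key : ∀ η : ℝ, 0 < η → ∀ᶠ y in atTop, H y * (1 - η) ≤ Real.exp (2 * η) * (1 + η) ∧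
      1 - η - M * η ≤ Real.exp (2 * η) * H y := by
    intro η hη
    have hρ : Tendsto (fun l : ℝ => ∫ v in (-(l * η))..(l * η), fejerKernel v) atTop (𝓝 c) := by
      have ht : Tendsto (fun l : ℝ => l * η) atTop atTop := tendsto_id.atTop_mul_const hη
      exact intervalIntegral_tendsto_integral integrable_fejerKernel
        (tendsto_neg_atTop_atBot.comp ht) ht
    obtain ⟨l, hl1, hl0⟩ := ((hρ.eventually_const_lt (show c * (1 - η) < c by nlinarith)).and
      (eventually_gt_atTop 0)).exists
    set ρ := ∫ v in (-(l * η))..(l * η), fejerKernel v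
    have hlc : 0 < l⁻¹ * c := by positivity
    have hli : 0 < l⁻¹ := by positivity
    have hup := ((hlim hl0).comp (tendsto_atTop_add_const_right atTop η tendsto_id)).eventually_lt_const
      (show l⁻¹ * c < l⁻¹ * c * (1 + η) by nlinarith)
    have hlo := ((hlim hl0).comp (tendsto_atTop_add_const_right atTop (-η) tendsto_id)).eventually_const_lt
      (show l⁻¹ * c * (1 - η) < l⁻¹ * c by nlinarith)
    filter_upwards [hup, hlo, eventually_gt_atTop (0 : ℝ)] with y hy1 hy2 hy0
    simp only [Function.comp_apply, id] at hy1 hy2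
    constructor
    -- Upper bound: with centre `y + η` the window lies to the right of `y`, where `H` is at least
    -- `exp (-(2 * η)) * H y`; the rest of the average is nonnegative.
    · have h1 : Real.exp (-(2 * η)) * H y * (l⁻¹ * ρ) ≤
          ∫ u in Set.Ioi (0 : ℝ), H u * fejerKernel (l * (y + η - u)) := by
        rw [← setIntegral_fejerKernel_comp hl0 hη (y + η), ← integral_const_mul]
        refine le_trans (setIntegral_mono_on
          ((integrable_fejerKernel_comp hl0 _).integrableOn.const_mul _)
          (hint hl0 (y + η)).integrableOn measurableSet_Ioc fun u hu => ?_)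
          (setIntegral_mono_set (hint hl0 (y + η)).integrableOn
            (ae_of_all _ fun u => mul_nonneg (hH0 u) (fejerKernel_nonneg _))
            (LE.le.eventuallyLE fun u hu => ?_))
        · refine mul_le_mul_of_nonneg_right ?_ (fejerKernel_nonneg _)
          have h2 := hslow y (u - y) (by linarith [hu.1])
          have h3 : Real.exp (u - y) ≤ Real.exp (2 * η) := Real.exp_le_exp.2 (by linarith [hu.2])
          rw [Real.exp_neg, inv_mul_le_iff₀ (Real.exp_pos _)]
          rw [add_sub_cancel] at h2
          exact h2.trans (mul_le_mul_of_nonneg_right h3 (hH0 u))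
        · exact lt_of_lt_of_le hy0 (by linarith [hu.1])
      rw [Real.exp_neg] at h1
      have h4 : (Real.exp (2 * η))⁻¹ * H y * (l⁻¹ * (c * (1 - η))) ≤ l⁻¹ * c * (1 + η) := by
        refine le_trans (mul_le_mul_of_nonneg_left ?_ ?_) (h1.trans hy1.le)
        · gcongr
        · have := hH0 y
          positivity
      have hE := Real.exp_pos (2 * η)
      have h5 : (Real.exp (2 * η))⁻¹ * (H y * (1 - η)) ≤ 1 + η := by
        refine le_of_mul_le_mul_left ?_ hlc
        linarith
      rwa [inv_mul_le_iff₀ hE] at h5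
    -- Lower bound: with centre `y - η` the window lies to the left of `y`, where `H` is at most
    -- `exp (2 * η) * H y`; outside it `H ≤ M` meets only the small remaining mass.
    · have h1 : ∫ u in Set.Ioi (0 : ℝ), H u * fejerKernel (l * (y + -η - u)) ≤
          Real.exp (2 * η) * H y * (l⁻¹ * c) + M * (l⁻¹ * c - l⁻¹ * ρ) := by
        rw [← setIntegral_fejerKernel_comp hl0 hη (y + -η), hc,
          ← integral_fejerKernel_comp hl0 (y + -η), ← integral_indicator measurableSet_Ioc]
        have hK := integrable_fejerKernel_comp hl0 (y + -η)
        have hKi := hK.indicator (measurableSet_Ioc (a := y + -η - η) (b := y + -η + η))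
        have hKs : Integrable fun u => M * (fejerKernel (l * (y + -η - u)) -
            (Set.Ioc (y + -η - η) (y + -η + η)).indicator
              (fun u => fejerKernel (l * (y + -η - u))) u) := (hK.sub hKi).const_mul M
        rw [← integral_sub hK hKi, ← integral_const_mul, ← integral_const_mul,
          ← integral_add (hK.const_mul _) hKs]
        refine (setIntegral_le_integral (hint hl0 _)
          (ae_of_all _ fun u => mul_nonneg (hH0 u) (fejerKernel_nonneg _))).trans
          (integral_mono (hint hl0 _) ((hK.const_mul _).add hKs) fun u => ?_)
        have hKu := fejerKernel_nonneg (l * (y + -η - u))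
        by_cases hu : u ∈ Set.Ioc (y + -η - η) (y + -η + η)
        · simp only [Set.indicator_of_mem hu, sub_self, mul_zero, add_zero]
          refine mul_le_mul_of_nonneg_right ?_ hKu
          have h2 := hslow u (y - u) (by linarith [hu.2])
          have h3 : Real.exp (y - u) ≤ Real.exp (2 * η) := Real.exp_le_exp.2 (by linarith [hu.1])
          rw [add_sub_cancel] at h2
          exact h2.trans (mul_le_mul_of_nonneg_right h3 (hH0 y))
        · simp only [Set.indicator_of_notMem hu, sub_zero]
          have := mul_le_mul_of_nonneg_right (hHM u) hKu
          have : 0 ≤ Real.exp (2 * η) * H y * fejerKernel (l * (y + -η - u)) := by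
            have := hH0 y
            positivity
          linarith
      have h2 : M * (l⁻¹ * c - l⁻¹ * ρ) ≤ M * (l⁻¹ * c * η) := by
        refine mul_le_mul_of_nonneg_left ?_ hM0
        have := mul_le_mul_of_nonneg_left hl1.le hli.le
        linarith
      refine le_of_mul_le_mul_left ?_ hlc
      linarith
  have hE : Tendsto (fun η : ℝ => Real.exp (2 * η) * (1 + η) / (1 - η)) (𝓝[>] 0) (𝓝 1) := by
    have : ContinuousAt (fun η : ℝ => Real.exp (2 * η) * (1 + η) / (1 - η)) 0 := by
      fun_prop (disch := norm_num)
    simpa [ContinuousAt] using this.tendsto.mono_left nhdsWithin_le_nhds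
  have hE' : Tendsto (fun η : ℝ => (1 - η - M * η) / Real.exp (2 * η)) (𝓝[>] 0) (𝓝 1) := by
    have : ContinuousAt (fun η : ℝ => (1 - η - M * η) / Real.exp (2 * η)) 0 := by
      fun_prop (disch := positivity)
    simpa [ContinuousAt] using this.tendsto.mono_left nhdsWithin_le_nhds
  refine tendsto_order.2 ⟨fun a ha => ?_, fun a ha => ?_⟩
  · obtain ⟨η, h1, hη⟩ := ((hE'.eventually_const_lt ha).and self_mem_nhdsWithin).exists
    filter_upwards [key η hη] with y hy
    refine h1.trans_le ?_
    rw [div_le_iff₀' (Real.exp_pos _)]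
    exact hy.2
  · obtain ⟨η, h1, hη0, hη1⟩ := ((hE.eventually_lt_const ha).and (Ioo_mem_nhdsGT zero_lt_one)).exists
    filter_upwards [key η hη0] with y hy
    refine lt_of_le_of_lt ?_ h1
    rw [le_div_iff₀ (by linarith)]
    exact hy.1

end Tauberian

/-! ### The prime number theorem. -/

section PrimeNumberTheorem

/-- Partial summation gives `L(Λ, s) = s ∫ ψ(t) t ^ (-s - 1) dt` over `t > 1`; substitute `t = e^u`
and `s = 1 + z`. -/
theorem laplace_psi_exp {z : ℂ} (hz : 0 < z.re) :
    ∫ u in Set.Ioi (0 : ℝ), ((Chebyshev.psi (Real.exp u) * Real.exp (-u) : ℝ) : ℂ)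
      * Complex.exp (-z * u) =
      LSeries (fun n => (ArithmeticFunction.vonMangoldt n : ℂ)) (1 + z) / (1 + z) := by
  have hs : 1 < (1 + z).re := by simpa using hz
  have hs0 : 1 + z ≠ 0 := fun h => by simp [h] at hs; linarith
  have hO : (fun n : ℕ => ∑ k ∈ Finset.Icc 1 n, ArithmeticFunction.vonMangoldt k) =O[atTop]
      fun n => (n : ℝ) ^ (1 : ℝ) := by
    refine IsBigO.of_bound (Real.log 4 + 4) (Eventually.of_forall fun n => ?_)
    have h := Chebyshev.psi_le_const_mul_self (Nat.cast_nonneg (α := ℝ) n)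
    have h0 := Chebyshev.psi_nonneg n
    rw [Chebyshev.psi, Nat.floor_natCast] at h h0
    rw [Real.rpow_one, Real.norm_natCast, Real.norm_eq_abs]
    rw [abs_of_nonneg]
    · exact h
    · exact h0
  rw [LSeries_eq_mul_integral_of_nonneg _ zero_le_one hs hO
    (fun n => ArithmeticFunction.vonMangoldt_nonneg), mul_div_cancel_left₀ _ hs0]
  have h := integral_comp_exp_Ioi (fun t : ℝ => (∑ k ∈ Finset.Icc 1 ⌊t⌋₊,
    (ArithmeticFunction.vonMangoldt k : ℂ)) * (t : ℂ) ^ (-(1 + z + 1))) 0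
  rw [Real.exp_zero] at h
  rw [← h]
  congr 1 with u
  have h1 : ((Chebyshev.psi (Real.exp u) : ℝ) : ℂ) = ∑ k ∈ Finset.Icc 1 ⌊Real.exp u⌋₊,
    (ArithmeticFunction.vonMangoldt k : ℂ) := by
    rw [Chebyshev.psi]
    push_cast
    rfl
  rw [← h1, Complex.ofReal_mul, Complex.real_smul, Complex.cpow_def_of_ne_zero (by simp),
    ← Complex.ofReal_log (Real.exp_pos u).le, Real.log_exp]
  have h2 : Complex.exp ((-u : ℝ) : ℂ) * Complex.exp (-z * u) =
      Complex.exp (u : ℂ) * Complex.exp (u * (-(1 + z + 1))) := by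
    rw [← Complex.exp_add, ← Complex.exp_add]
    push_cast
    ring_nf
  push_cast at h2 ⊢
  linear_combination (Chebyshev.psi (Real.exp u) : ℂ) * h2

theorem psi_exp_mul_exp_neg_le (u : ℝ) :
    Chebyshev.psi (Real.exp u) * Real.exp (-u) ≤ Real.log 4 + 4 := by
  rw [Real.exp_neg, ← div_eq_mul_inv, div_le_iff₀ (Real.exp_pos u)]
  exact Chebyshev.psi_le_const_mul_self (Real.exp_pos u).le

theorem measurable_psi_exp_mul_exp_neg :
    Measurable fun u : ℝ => Chebyshev.psi (Real.exp u) * Real.exp (-u) :=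
  (Chebyshev.psi_mono.measurable.comp Real.measurable_exp).mul (by fun_prop)

theorem tendsto_psi_exp_mul_exp_neg :
    Tendsto (fun u : ℝ => Chebyshev.psi (Real.exp u) * Real.exp (-u)) atTop (𝓝 1) := by
  -- For modulus `1`, `A` extends `-ζ'/ζ(s) - 1 / (s - 1)` continuously to `Re s ≥ 1`; the
  -- nonvanishing of `ζ` on `Re s = 1` enters here. Subtracting the transform `1 / z` of the
  -- constant `1` from `(A (1 + z) + 1 / z) / (1 + z)` leaves `(A (1 + z) - 1) / (1 + z)`.
  let A : ℂ → ℂ := ArithmeticFunction.vonMangoldt.LFunctionResidueClassAux (1 : ZMod 1)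
  have hne : ∀ z : ℂ, 0 ≤ z.re → 1 + z ≠ 0 := fun z hz h => by
    have := congrArg Complex.re h
    simp at this
    linarith
  refine tendsto_one_of_laplace (M := Real.log 4 + 4)
    (F := fun z => (A (1 + z) - 1) / (1 + z)) measurable_psi_exp_mul_exp_neg
    (fun u => mul_nonneg (Chebyshev.psi_nonneg _) (Real.exp_pos _).le) psi_exp_mul_exp_neg_le
    (fun u h hh => ?_) ?_ (fun z hz => ?_)
  · have h1 : Chebyshev.psi (Real.exp u) ≤ Chebyshev.psi (Real.exp (u + h)) :=
      Chebyshev.psi_mono (Real.exp_le_exp.2 (by linarith))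
    have h2 : Real.exp h * (Chebyshev.psi (Real.exp (u + h)) * Real.exp (-(u + h))) =
        Chebyshev.psi (Real.exp (u + h)) * Real.exp (-u) := by
      rw [mul_left_comm, ← Real.exp_add]
      ring_nf
    rw [h2]
    gcongr
  · refine ContinuousOn.div (ContinuousOn.sub ?_ continuousOn_const) (by fun_prop)
      (fun z hz => hne z hz)
    exact (ArithmeticFunction.vonMangoldt.continuousOn_LFunctionResidueClassAux (1 : ZMod 1)).comp
      (by fun_prop) fun z hz => by simpa using hz
  · have hA : A (1 + z) = LSeries (fun n => (ArithmeticFunction.vonMangoldt n : ℂ)) (1 + z) - 1 / z := by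
      have h := ArithmeticFunction.vonMangoldt.eqOn_LFunctionResidueClassAux
        (isUnit_one : IsUnit (1 : ZMod 1)) (show 1 < (1 + z).re by simpa using hz)
      have hr : ArithmeticFunction.vonMangoldt.residueClass (1 : ZMod 1) =
          fun n => ArithmeticFunction.vonMangoldt n := by
        funext n
        simp [ArithmeticFunction.vonMangoldt.residueClass, Set.indicator,
          Subsingleton.elim (n : ZMod 1) 1]
      simp only [hr] at h
      simpa using h
    have hexp : IntegrableOn (fun u : ℝ => Complex.exp (-z * u)) (Set.Ioi 0) :=
      integrableOn_exp_mul_complex_Ioi (by simpa using hz) 0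
    have hH : IntegrableOn (fun u : ℝ => ((Chebyshev.psi (Real.exp u) * Real.exp (-u) : ℝ) : ℂ)
        * Complex.exp (-z * u)) (Set.Ioi 0) := by
      refine Integrable.bdd_mul (c := Real.log 4 + 4) hexp
        (Complex.measurable_ofReal.comp measurable_psi_exp_mul_exp_neg).aestronglyMeasurable
        (ae_of_all _ fun u => ?_)
      rw [Complex.norm_real, Real.norm_of_nonneg
        (mul_nonneg (Chebyshev.psi_nonneg _) (Real.exp_pos _).le)]
      exact psi_exp_mul_exp_neg_le u
    have hz0 : z ≠ 0 := fun h => by simp [h] at hz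
    simp_rw [Complex.ofReal_sub, sub_mul, Complex.ofReal_one, one_mul]
    rw [integral_sub hH hexp, laplace_psi_exp hz, integral_exp_mul_complex_Ioi (by simpa using hz),
      hA]
    have := hne z hz.le
    simp
    field_simp
    ring

/-- The prime number theorem for the Chebyshev function `ψ`. -/
theorem tendsto_psi_div : Tendsto (fun x => Chebyshev.psi x / x) atTop (𝓝 1) := by
  refine (tendsto_psi_exp_mul_exp_neg.comp Real.tendsto_log_atTop).congr' ?_
  filter_upwards [eventually_gt_atTop 0] with x hx
  simp [Real.exp_log hx, Real.exp_neg, div_eq_mul_inv]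

theorem tendsto_theta_div : Tendsto (fun x => Chebyshev.theta x / x) atTop (𝓝 1) := by
  have h1 : Tendsto (fun x => (Chebyshev.psi - Chebyshev.theta) x / x) atTop (𝓝 0) := by
    refine (Chebyshev.isBigO_psi_sub_theta_sqrt.trans_isLittleO
      (isLittleO_of_tendsto (g := id) (fun x hx => by simp_all) ?_)).tendsto_div_nhds_zero
    simp only [id, Real.sqrt_div_self]
    exact Real.tendsto_sqrt_atTop.inv_tendsto_atTop
  have h2 := tendsto_psi_div.sub h1
  rw [sub_zero] at h2
  refine h2.congr fun x => ?_
  simp only [Pi.sub_apply]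
  ring

/-- The **prime number theorem**. -/
theorem tendsto_primeCounting_mul_log_div :
    Tendsto (fun x : ℝ => (Nat.primeCounting ⌊x⌋₊ : ℝ) * Real.log x / x) atTop (𝓝 1) := by
  have h1 := Chebyshev.integral_theta_div_log_sq_isLittleO.tendsto_div_nhds_zero
  have h2 := tendsto_theta_div.add h1
  rw [add_zero] at h2
  refine h2.congr' ?_
  filter_upwards [eventually_ge_atTop 2] with x hx
  rw [Chebyshev.primeCounting_eq_theta_div_log_add_integral hx]
  have : 0 < Real.log x := Real.log_pos (by linarith)
  field_simp

end PrimeNumberTheorem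

/-! ### A lower bound for `φ(q) / q`. -/

section Totient

/-- The `j`-th smallest element is at least `2j + 1`, so the product dominates the telescoping
product of `(2j - 1) / (2j + 1)`. -/
theorem inv_two_mul_card_add_one_le_prod (S : Finset ℕ) (hS : ∀ n ∈ S, Odd n ∧ 3 ≤ n) :
    (2 * (S.card : ℝ) + 1)⁻¹ ≤ ∏ n ∈ S, (1 - 2 / (n : ℝ)) := by
  induction S using Finset.induction_on_max with
  | empty => simp
  | insert a S hmax ih =>
    have ha : a ∉ S := fun h => (hmax a h).false
    have ih := ih fun n hn => hS n (Finset.mem_insert_of_mem hn)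
    obtain ⟨⟨k, hk⟩, ha3⟩ := hS a (Finset.mem_insert_self a S)
    -- Halving injects `S` into `{1, …, k - 1}`, since its elements are odd, at least `3` and below
    -- `a = 2k + 1`.
    have hcard : S.card ≤ k - 1 := by
      rw [← Nat.card_Ico 1 k]
      refine Finset.card_le_card_of_injOn (· / 2) (fun n hn => ?_) fun n hn m hm hnm => ?_
      · obtain ⟨⟨j, hj⟩, h3⟩ := hS n (Finset.mem_insert_of_mem hn)
        have := hmax n hn
        simp only [Finset.coe_Ico, Set.mem_Ico]
        omega
      · obtain ⟨⟨i, hi⟩, -⟩ := hS n (Finset.mem_insert_of_mem hn)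
        obtain ⟨⟨j, hj⟩, -⟩ := hS m (Finset.mem_insert_of_mem hm)
        simp only at hnm
        omega
    have hle : (2 * (S.card : ℝ) + 3) ≤ a := by
      have : 2 * S.card + 3 ≤ a := by omega
      exact_mod_cast this
    rw [Finset.prod_insert ha, Finset.card_insert_of_notMem ha]
    push_cast
    have hs : (0 : ℝ) ≤ S.card := Nat.cast_nonneg _
    have h1 : (2 * (S.card : ℝ) + 1) / (2 * S.card + 3) ≤ 1 - 2 / (a : ℝ) := by
      have : 2 / (a : ℝ) ≤ 2 / (2 * S.card + 3) := by gcongr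
      have h2 : (2 * (S.card : ℝ) + 1) / (2 * S.card + 3) = 1 - 2 / (2 * S.card + 3) := by
        field_simp
        ring
      linarith
    calc (2 * ((S.card : ℝ) + 1) + 1)⁻¹
        = (2 * (S.card : ℝ) + 1) / (2 * S.card + 3) * (2 * (S.card : ℝ) + 1)⁻¹ := by
          field_simp
          ring
      _ ≤ _ := mul_le_mul h1 ih (by positivity) (le_trans (by positivity) h1)

/-- Squaring Euler's product gives factors `(1 - 1/p) ^ 2 ≥ 1 - 2/p`, to which the telescoping bound
applies. The prime `2`, where `1 - 2/p` vanishes, is set aside and accounts for the factor `4`. The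
number of prime factors is at most `log₂ q`. -/
theorem one_le_totient_div_sq_mul (q : ℕ) (hq : 0 < q) :
    1 ≤ ((q.totient : ℝ) / q) ^ 2 * (4 * (2 * (Real.log q / Real.log 2) + 1)) := by
  have hl2 : 0 < Real.log 2 := Real.log_pos one_lt_two
  have hcard : (q.primeFactors.card : ℝ) ≤ Real.log q / Real.log 2 := by
    rw [le_div_iff₀ hl2, ← Real.log_pow]
    refine Real.log_le_log (by positivity) ?_
    have h : 2 ^ q.primeFactors.card ≤ ∏ p ∈ q.primeFactors, p :=
      Finset.pow_card_le_prod _ _ _ fun p hp => (Nat.prime_of_mem_primeFactors hp).two_le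
    exact_mod_cast h.trans (Nat.le_of_dvd hq (Nat.prod_primeFactors_dvd q))
  have hprod : ((q.totient : ℝ) / q) = ∏ p ∈ q.primeFactors, (1 - (p : ℝ)⁻¹) := by
    have h := congrArg (fun r : ℚ => (r : ℝ)) (Nat.totient_eq_mul_prod_factors q)
    push_cast at h
    rw [h, mul_div_cancel_left₀ _ (by positivity)]
  have hodd := inv_two_mul_card_add_one_le_prod (q.primeFactors.erase 2) fun p hp => by
    have hp' := Nat.prime_of_mem_primeFactors (Finset.mem_of_mem_erase hp)
    have h2 := Finset.ne_of_mem_erase hp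
    refine ⟨hp'.odd_of_ne_two h2, ?_⟩
    have := hp'.two_le
    omega
  have hstep : 4⁻¹ * ∏ p ∈ q.primeFactors.erase 2, (1 - 2 / (p : ℝ)) ≤
      ((q.totient : ℝ) / q) ^ 2 := by
    rw [hprod, ← Finset.prod_pow]
    have hle : ∏ p ∈ q.primeFactors.erase 2, (1 - 2 / (p : ℝ)) ≤
        ∏ p ∈ q.primeFactors.erase 2, (1 - (p : ℝ)⁻¹) ^ 2 := by
      refine Finset.prod_le_prod (fun p hp => ?_) fun p hp => ?_
      · have := (Nat.prime_of_mem_primeFactors (Finset.mem_of_mem_erase hp)).two_le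
        rw [sub_nonneg, div_le_one (by positivity)]
        exact_mod_cast this
      · have := sq_nonneg ((p : ℝ)⁻¹)
        rw [div_eq_mul_inv]
        linarith
    have h0 : 0 ≤ ∏ p ∈ q.primeFactors.erase 2, (1 - (p : ℝ)⁻¹) ^ 2 :=
      Finset.prod_nonneg fun p _ => sq_nonneg _
    by_cases h2 : 2 ∈ q.primeFactors
    · rw [← Finset.mul_prod_erase _ _ h2]
      norm_num
      linarith
    · rw [Finset.erase_eq_of_notMem h2] at hle h0 ⊢
      linarith
  have hcard' : ((q.primeFactors.erase 2).card : ℝ) ≤ Real.log q / Real.log 2 :=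
    le_trans (by exact_mod_cast Finset.card_erase_le) hcard
  have h0 : (0 : ℝ) ≤ (q.primeFactors.erase 2).card := Nat.cast_nonneg _
  have h1 : 4⁻¹ * (2 * (Real.log q / Real.log 2) + 1)⁻¹ ≤ ((q.totient : ℝ) / q) ^ 2 := by
    refine le_trans ?_ hstep
    refine mul_le_mul_of_nonneg_left (le_trans ?_ hodd) (by norm_num)
    gcongr
  rw [← mul_inv, inv_le_iff_one_le_mul₀ (by linarith)] at h1
  exact h1

end Totient

/-! ### Expectations for fixed parameters. -/

namespace PrimeGen

/-- The tail formula: a value in `ℕ∞` is the number of `n` strictly below it, also when it is `⊤`.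
-/
theorem iInf_succ_eq_tsum (P : ℕ → Prop) :
    ((⨅ (k : ℕ) (_ : P k), ((k + 1 : ℕ) : ℕ∞) : ℕ∞) : ℝ≥0∞) =
      ∑' n : ℕ, {n : ℕ | ∀ k < n, ¬ P k}.indicator 1 n := by
  classical
  by_cases h : ∃ k, P k
  · have h1 : (⨅ (k : ℕ) (_ : P k), ((k + 1 : ℕ) : ℕ∞)) = ((Nat.find h + 1 : ℕ) : ℕ∞) := by
      refine le_antisymm (iInf₂_le _ (Nat.find_spec h)) (le_iInf₂ fun k hk => ?_)
      exact_mod_cast Nat.succ_le_succ (Nat.find_min' h hk)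
    have h2 : {n : ℕ | ∀ k < n, ¬ P k} = Finset.range (Nat.find h + 1) := by
      ext n
      simp only [Set.mem_ofPred_eq, Finset.coe_range, Set.mem_Iio, Nat.lt_succ_iff, Nat.le_find_iff]
    rw [h1, h2, tsum_eq_sum (s := Finset.range (Nat.find h + 1)) fun n hn =>
      Set.indicator_of_notMem (by simpa using hn) _,
      Finset.sum_congr rfl fun n hn => Set.indicator_of_mem (Finset.mem_coe.2 hn) _]
    simp
  · push Not at h
    simp [h]

theorem iterations_eq_tsum (q : ℕ+) (ω : Run) :
    (iterations q ω : ℝ≥0∞) =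
      ∑' n : ℕ, {ω : Run | ∀ k < n, ¬ (candidate q ω k).Prime}.indicator 1 ω := by
  rw [iterations, iInf_succ_eq_tsum]
  rfl

theorem measurable_candidate (q : ℕ+) (k : ℕ) : Measurable fun ω : Run => candidate q ω k := by
  unfold candidate
  fun_prop

theorem measurableSet_no_prime (q : ℕ+) (n : ℕ) :
    MeasurableSet {ω : Run | ∀ k < n, ¬ (candidate q ω k).Prime} := by
  have : {ω : Run | ∀ k < n, ¬ (candidate q ω k).Prime} =
      ⋂ k ∈ Set.Iio n, (fun ω => candidate q ω k) ⁻¹' {m | ¬ m.Prime} := by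
    ext ω
    simp
  rw [this]
  exact MeasurableSet.biInter (Set.to_countable _) fun k _ =>
    measurable_candidate q k (MeasurableSet.of_discrete)

theorem measurable_iterations (q : ℕ+) : Measurable fun ω : Run => (iterations q ω : ℝ≥0∞) := by
  simp_rw [iterations_eq_tsum]
  exact Measurable.tsum fun n => measurable_one.indicator (measurableSet_no_prime q n)

theorem measurable_drawBits_tRange (x : ℝ) (q : ℕ+) :
    Measurable fun ω : Run => drawBits (tRange x q ω.1) :=
  (measurable_from_nat (f := fun a => drawBits (tRange x q a))).comp measurable_fst

theorem terminates_of_iterations_lt_top {q : ℕ+} {ω : Run} (h : (iterations q ω : ℝ≥0∞) < ⊤) :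
    Terminates q ω := by
  by_contra hT
  simp only [Terminates, not_exists] at hT
  simp [iterations, hT] at h

/-- The number of primes among the possible values of `a + t * q`. -/
noncomputable def primeHits (x : ℝ) (q : ℕ+) (a : ℕ) : Finset ℕ :=
  (tRange x q a).filter fun t => (a + t * q).Prime

/-- The number of iterations, given `a`, follows a geometric law. -/
theorem lintegral_iterations_loopLaw (x : ℝ) (q : ℕ+) (a : ℕ) :
    ∫⁻ t, (iterations q (a, t) : ℝ≥0∞) ∂(loopLaw x q a) =
      ((primeHits x q a).card / (tRange x q a).card : ℝ≥0∞)⁻¹ := by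
  set μ := (PMF.uniformOfFinset (tRange x q a) (tRange_nonempty x q a)).toMeasure with hμ
  have hlaw : loopLaw x q a = Measure.infinitePi fun _ : ℕ => μ := rfl
  set S : Set ℕ := {t | ¬ (a + t * q).Prime} with hS
  have hScompl : μ Sᶜ = ((primeHits x q a).card / (tRange x q a).card : ℝ≥0∞) := by
    rw [hμ, PMF.toMeasure_uniformOfFinset_apply _ _ MeasurableSet.of_discrete]
    congr 3
    simp [primeHits, hS]
  have hmeas : Measurable fun t : ℕ → ℕ => ((a, t) : Run) := by fun_prop
  have hset (n : ℕ) : loopLaw x q a {t | ∀ k < n, ¬ (candidate q (a, t) k).Prime} = μ S ^ n := by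
    have h := Measure.infinitePi_pi (fun _ : ℕ => μ) (s := Finset.range n) (t := fun _ => S)
      fun _ _ => MeasurableSet.of_discrete
    rw [Finset.prod_const, Finset.card_range] at h
    rw [hlaw, ← h]
    congr 1
    ext t
    simp [candidate, hS, Set.mem_pi]
  simp_rw [iterations_eq_tsum]
  have hind (n : ℕ) : Measurable fun t : ℕ → ℕ =>
      {ω : Run | ∀ k < n, ¬ (candidate q ω k).Prime}.indicator (1 : Run → ℝ≥0∞) (a, t) :=
    (measurable_one.indicator (measurableSet_no_prime q n)).comp hmeas
  rw [lintegral_tsum fun n => (hind n).aemeasurable]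
  have h1 (n : ℕ) : ∫⁻ t, {ω : Run | ∀ k < n, ¬ (candidate q ω k).Prime}.indicator 1 (a, t)
      ∂(loopLaw x q a) = μ S ^ n := by
    rw [← hset n, ← lintegral_indicator_one]
    · rfl
    · exact hmeas (measurableSet_no_prime q n)
  simp_rw [h1]
  -- If no `t` yields a prime, both sides are `0⁻¹ = ⊤`.
  rw [ENNReal.tsum_geometric, ← hScompl, prob_compl_eq_one_sub MeasurableSet.of_discrete]

theorem ae_mem_unitReps (q : ℕ+) : ∀ᵐ a ∂(residueLaw q), a ∈ unitReps q := by
  rw [residueLaw, ae_iff]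
  rw [PMF.toMeasure_uniformOfFinset_apply _ _ MeasurableSet.of_discrete]
  simp

theorem lintegral_runLaw_mem_Icc {x : ℝ} {q : ℕ+} {f : Run → ℝ≥0∞} (hf : Measurable f)
    {A B : ℝ≥0∞} (h : ∀ a ∈ unitReps q, ∫⁻ t, f (a, t) ∂(loopLaw x q a) ∈ Set.Icc A B) :
    ∫⁻ ω, f ω ∂(runLaw x q) ∈ Set.Icc A B := by
  rw [runLaw, Measure.lintegral_compProd hf]
  constructor
  · calc A = ∫⁻ _, A ∂(residueLaw q) := by simp
      _ ≤ _ := lintegral_mono_ae ((ae_mem_unitReps q).mono fun a ha => (h a ha).1)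
  · calc _ ≤ ∫⁻ _, B ∂(residueLaw q) :=
          lintegral_mono_ae ((ae_mem_unitReps q).mono fun a ha => (h a ha).2)
      _ = B := by simp

theorem lintegral_randomBits_loopLaw (x : ℝ) (q : ℕ+) (a : ℕ) :
    ∫⁻ t, randomBits x q (a, t) ∂(loopLaw x q a) = drawBits (unitReps q) +
      ((primeHits x q a).card / (tRange x q a).card : ℝ≥0∞)⁻¹ * drawBits (tRange x q a) := by
  simp only [randomBits]
  have hm : Measurable fun t : ℕ → ℕ => (iterations q (a, t) : ℝ≥0∞) :=
    (measurable_iterations q).comp (by fun_prop)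
  rw [lintegral_add_left measurable_const, lintegral_const, measure_univ, mul_one,
    lintegral_mul_const _ hm, lintegral_iterations_loopLaw]

theorem measurable_randomBits (x : ℝ) (q : ℕ+) : Measurable (randomBits x q) :=
  measurable_const.add ((measurable_iterations q).mul (measurable_drawBits_tRange x q))

/-- The bijection is `t ↦ a + t * q`, with inverse `p ↦ p / q`. As `a < q ≤ x`, the natural-number
floor in `tRange` does not truncate a negative number. -/
theorem card_primeHits {x : ℝ} {q : ℕ+} (hqx : (q : ℝ) ≤ x) {a : ℕ} (ha : a ∈ unitReps q) :
    (primeHits x q a).card = primeCountingAP x q a := by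
  have haq : a < q := Finset.mem_range.1 (Finset.mem_filter.1 ha).1
  have hax : (a : ℝ) ≤ x := le_trans (by exact_mod_cast haq.le) hqx
  have hq0 : (0 : ℝ) < (q : ℕ) := by exact_mod_cast q.pos
  have hmem (t : ℕ) : t ∈ tRange x q a ↔ a + t * q ≤ ⌊x⌋₊ := by
    rw [tRange, Finset.mem_range, Nat.lt_succ_iff,
      Nat.le_floor_iff (div_nonneg (by linarith) hq0.le), Nat.le_floor_iff (by linarith [Nat.cast_nonneg (α := ℝ) a]),
      le_div_iff₀ hq0]
    push_cast
    constructor <;> intro h <;> linarith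
  refine Finset.card_bij (fun t _ => a + t * q) (fun t ht => ?_) (fun t _ s _ h => ?_)
    fun p hp => ?_
  · obtain ⟨h1, h2⟩ := Finset.mem_filter.1 ht
    refine Finset.mem_filter.2 ⟨Finset.mem_range.2 (Nat.lt_succ_iff.2 ((hmem t).1 h1)), h2, ?_⟩
    simp [Nat.ModEq]
  · exact Nat.eq_of_mul_eq_mul_right q.pos (Nat.add_left_cancel h)
  · obtain ⟨h1, h2, h3⟩ := Finset.mem_filter.1 hp
    have hmod : p % q = a := by rw [h3, Nat.mod_eq_of_lt haq]
    have hp' : a + p / q * q = p := by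
      conv_rhs => rw [← Nat.mod_add_div p q, hmod, mul_comm]
    refine ⟨p / q, Finset.mem_filter.2 ⟨(hmem _).2 ?_, ?_⟩, hp'⟩
    · rw [hp']; exact Nat.lt_succ_iff.1 (Finset.mem_range.1 h1)
    · rwa [hp']

end PrimeGen

/-! ### Uniformity in the residue, and the passage to `o(1)` form. -/

/-- Apply the hypothesis to a selector that picks a counterexample whenever one exists. Asymptotics
can thus be proved as limits along an arbitrary choice `a x` and still hold uniformly in `a`. -/
theorem eventually_forall_mem_of_forall_selector {ι α : Type*} {l : Filter ι} {S : ι → Finset α}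
    (hS : ∀ i, (S i).Nonempty) {P : ι → α → Prop}
    (h : ∀ a : ι → α, (∀ i, a i ∈ S i) → ∀ᶠ i in l, P i (a i)) :
    ∀ᶠ i in l, ∀ a ∈ S i, P i a := by
  classical
  have hsel : ∀ i, ∃ a ∈ S i, P i a → ∀ b ∈ S i, P i b := fun i => by
    by_cases hi : ∃ b ∈ S i, ¬ P i b
    · obtain ⟨b, hb, hPb⟩ := hi
      exact ⟨b, hb, fun h => absurd h hPb⟩
    · push Not at hi
      obtain ⟨a, ha⟩ := hS i
      exact ⟨a, ha, fun _ => hi⟩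
  choose a ha hP using hsel
  exact (h a ha).mono fun i hi => hP i hi

theorem exists_tendsto_zero_eq_ofReal {ι : Type*} {l : Filter ι} {V : ι → ℝ≥0∞} {m : ι → ℝ} {c : ℝ}
    (hc : 0 ≤ c) (hm : ∀ᶠ i in l, 0 < m i)
    (h : ∀ η > 0, ∀ᶠ i in l,
      V i ∈ Set.Icc (ENNReal.ofReal ((c - η) * m i)) (ENNReal.ofReal ((c + η) * m i))) :
    ∃ δ : ι → ℝ, Tendsto δ l (𝓝 0) ∧ ∀ᶠ i in l, V i = ENNReal.ofReal ((c + δ i) * m i) := by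
  refine ⟨fun i => (V i).toReal / m i - c, ?_, ?_⟩
  · rw [Metric.tendsto_nhds]
    intro η hη
    filter_upwards [hm, h (η / 2) (half_pos hη)] with i hi ⟨h1, h2⟩
    have hV : V i ≠ ⊤ := ne_top_of_le_ne_top ENNReal.ofReal_ne_top h2
    have h1' := (ENNReal.ofReal_le_iff_le_toReal hV).1 h1
    have h2' := ENNReal.toReal_le_of_le_ofReal (by positivity) h2
    rw [← le_div_iff₀ hi] at h1'
    rw [← div_le_iff₀ hi] at h2'
    rw [Real.dist_eq, sub_zero, abs_lt]
    constructor <;> linarith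
  · filter_upwards [hm, h 1 one_pos] with i hi ⟨h1, h2⟩
    have hV : V i ≠ ⊤ := ne_top_of_le_ne_top ENNReal.ofReal_ne_top h2
    rw [add_sub_cancel, div_mul_cancel₀ _ hi.ne', ENNReal.ofReal_toReal hV]

/-! ### Asymptotics along a choice of residues. -/

namespace PrimeGen

section Asymptotics

variable {ε : ℝ} {q : ℝ → ℕ+}

theorem exists_bounds_div (hq : (fun x : ℝ => ((q x : ℕ) : ℝ)) =Θ[atTop] fun x : ℝ => x ^ (1 - ε)) :
    ∃ c > 0, ∃ C > 0, ∀ᶠ x : ℝ in atTop, c * x ^ ε ≤ x / (q x : ℕ) ∧ x / (q x : ℕ) ≤ C * x ^ ε := by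
  obtain ⟨A, hA, h1⟩ := hq.1.exists_pos
  obtain ⟨B, hB, h2⟩ := hq.2.exists_pos
  refine ⟨A⁻¹, inv_pos.2 hA, B, hB, ?_⟩
  filter_upwards [h1.bound, h2.bound, eventually_gt_atTop 0] with x hx1 hx2 hx0
  have hq0 : (0 : ℝ) < (q x : ℕ) := by exact_mod_cast (q x).pos
  have hr : 0 < x ^ ε := Real.rpow_pos_of_pos hx0 _
  rw [Real.norm_of_nonneg hq0.le, Real.norm_of_nonneg (by positivity), Real.rpow_sub hx0,
    Real.rpow_one] at hx1 hx2
  constructor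
  · rw [le_div_iff₀ hq0]
    calc A⁻¹ * x ^ ε * (q x : ℕ) ≤ A⁻¹ * x ^ ε * (A * (x / x ^ ε)) := by gcongr
      _ = x := by field_simp
  · rw [div_le_iff₀ hq0]
    rw [div_le_iff₀ hr] at hx2
    linarith

theorem tendsto_div_atTop (hε₀ : 0 < ε)
    (hq : (fun x : ℝ => ((q x : ℕ) : ℝ)) =Θ[atTop] fun x : ℝ => x ^ (1 - ε)) :
    Tendsto (fun x : ℝ => x / (q x : ℕ)) atTop atTop := by
  obtain ⟨c, hc, C, hC, h⟩ := exists_bounds_div hq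
  exact tendsto_atTop_mono' _ (h.mono fun x hx => hx.1)
    ((tendsto_rpow_atTop hε₀).const_mul_atTop hc)

theorem tendsto_log_div_div_log
    (hq : (fun x : ℝ => ((q x : ℕ) : ℝ)) =Θ[atTop] fun x : ℝ => x ^ (1 - ε)) :
    Tendsto (fun x : ℝ => Real.log (x / (q x : ℕ)) / Real.log x) atTop (𝓝 ε) := by
  obtain ⟨c, hc, C, hC, h⟩ := exists_bounds_div hq
  have hlim (b : ℝ) : Tendsto (fun x : ℝ => b / Real.log x + ε) atTop (𝓝 ε) := by
    simpa using (Real.tendsto_log_atTop.const_div_atTop b).add_const ε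
  refine tendsto_of_tendsto_of_tendsto_of_le_of_le' (hlim (Real.log c)) (hlim (Real.log C)) ?_ ?_
  all_goals
    filter_upwards [h, eventually_gt_atTop 1] with x hx hx1
    have hl := Real.log_pos hx1
    have hr : 0 < x ^ ε := Real.rpow_pos_of_pos (by linarith) _
    have hq0 : (0 : ℝ) < (q x : ℕ) := by exact_mod_cast (q x).pos
    rw [div_add' _ _ _ hl.ne', div_le_div_iff_of_pos_right hl, ← Real.log_rpow (by linarith),
      ← Real.log_mul (by positivity) hr.ne']
  · exact Real.log_le_log (by positivity) hx.1
  · exact Real.log_le_log (by positivity) hx.2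

theorem tendsto_card_tRange_div (hε₀ : 0 < ε)
    (hq : (fun x : ℝ => ((q x : ℕ) : ℝ)) =Θ[atTop] fun x : ℝ => x ^ (1 - ε))
    {a : ℝ → ℕ} (ha : ∀ x, a x ∈ unitReps (q x)) :
    Tendsto (fun x : ℝ => ((tRange x (q x) (a x)).card : ℝ) / (x / (q x : ℕ))) atTop (𝓝 1) := by
  have hX := tendsto_div_atTop hε₀ hq
  have h0 : Tendsto (fun x : ℝ => 1 / (x / (q x : ℕ))) atTop (𝓝 0) := hX.const_div_atTop 1
  have hlo := h0.const_sub 1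
  have hhi := h0.const_add 1
  rw [sub_zero] at hlo
  rw [add_zero] at hhi
  refine tendsto_of_tendsto_of_tendsto_of_le_of_le' hlo hhi ?_ ?_
  all_goals
    filter_upwards [hX.eventually_ge_atTop 1] with x hx
    have hq0 : (0 : ℝ) < (q x : ℕ) := by exact_mod_cast (q x).pos
    have haq : (a x : ℝ) < (q x : ℕ) := by
      exact_mod_cast Finset.mem_range.1 (Finset.mem_filter.1 (ha x)).1
    have hX0 : 0 < x / (q x : ℕ) := by linarith
    have hqx := hx
    rw [le_div_iff₀ hq0, one_mul] at hqx
    have hd : (x - a x) / (q x : ℕ) = x / (q x : ℕ) - a x / (q x : ℕ) := sub_div _ _ _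
    have hd1 : (a x : ℝ) / (q x : ℕ) < 1 := (div_lt_one hq0).2 haq
    have hd0 : 0 ≤ (a x : ℝ) / (q x : ℕ) := by positivity
    rw [tRange, Finset.card_range]
    push_cast
  · rw [le_div_iff₀ hX0, sub_mul, one_div_mul_cancel hX0.ne', one_mul]
    have := Nat.lt_floor_add_one ((x - a x) / (q x : ℕ))
    linarith
  · rw [div_le_iff₀ hX0, add_mul, one_div_mul_cancel hX0.ne', one_mul]
    have := Nat.floor_le (show 0 ≤ (x - a x) / (q x : ℕ) by rw [hd]; linarith)
    linarith

/-- Multiplied by `φ(q) log x / x ≤ q log x / x`, the conjectural error becomes `O((x / q) ^ (-1/2)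
* x ^ (ε / 4) * log x) = O(x ^ (-ε / 4) * log x)`; the main term is the prime number theorem. -/
theorem tendsto_primeCountingAP (hFGM : FriedlanderGranvilleMontgomery) (hε₀ : 0 < ε)
    (hq : (fun x : ℝ => ((q x : ℕ) : ℝ)) =Θ[atTop] fun x : ℝ => x ^ (1 - ε))
    {a : ℝ → ℕ} (ha : ∀ x, a x ∈ unitReps (q x)) :
    Tendsto (fun x : ℝ => (primeCountingAP x (q x) (a x) : ℝ) * (q x : ℕ).totient * Real.log x / x)
      atTop (𝓝 1) := by
  obtain ⟨K, hK⟩ := hFGM (ε / 4) (by linarith)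
  obtain ⟨c, hc, C, hC, h⟩ := exists_bounds_div hq
  have hX := tendsto_div_atTop hε₀ hq
  have herr : Tendsto (fun x : ℝ => |K| * c ^ (-(1 / 2) : ℝ) * (Real.log x / x ^ (ε / 4))) atTop
      (𝓝 0) := by
    simpa using (isLittleO_log_rpow_atTop (show 0 < ε / 4 by linarith)).tendsto_div_nhds_zero.const_mul
      (|K| * c ^ (-(1 / 2) : ℝ))
  have hdiff : Tendsto (fun x : ℝ => (primeCountingAP x (q x) (a x) : ℝ) * (q x : ℕ).totient *
      Real.log x / x - (Nat.primeCounting ⌊x⌋₊ : ℝ) * Real.log x / x) atTop (𝓝 0) := by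
    refine squeeze_zero_norm' ?_ herr
    filter_upwards [h, hX.eventually_gt_atTop 1, eventually_gt_atTop 1] with x hx hX1 hx1
    have hx0 : 0 < x := by linarith
    have hq0 : (0 : ℝ) < (q x : ℕ) := by exact_mod_cast (q x).pos
    have hX0 : 0 < x / (q x : ℕ) := by linarith
    have hφ0 : (0 : ℝ) < (q x : ℕ).totient := by exact_mod_cast Nat.totient_pos.2 (q x).pos
    have hφq : ((q x : ℕ).totient : ℝ) ≤ (q x : ℕ) := by exact_mod_cast Nat.totient_le _
    have hl := Real.log_pos hx1
    rw [lt_div_iff₀ hq0, one_mul] at hX1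
    have h1 := hK x (q x) (a x) (q x).pos hX1 (Finset.mem_filter.1 (ha x)).2.symm
    have h2 : (primeCountingAP x (q x) (a x) : ℝ) * (q x : ℕ).totient * Real.log x / x -
        (Nat.primeCounting ⌊x⌋₊ : ℝ) * Real.log x / x =
        ((primeCountingAP x (q x) (a x) : ℝ) -
          (Nat.primeCounting ⌊x⌋₊ : ℝ) / ((q x : ℕ).totient : ℝ)) *
          ((q x : ℕ).totient * Real.log x / x) := by
      field_simp
    rw [h2, norm_mul, Real.norm_eq_abs, Real.norm_of_nonneg (by positivity)]
    have h3 : (x / (q x : ℕ)) ^ (-(1 / 2) : ℝ) ≤ (c * x ^ ε) ^ (-(1 / 2) : ℝ) :=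
      Real.rpow_le_rpow_of_nonpos (by positivity) hx.1 (by norm_num)
    have h4 : (c * x ^ ε) ^ (-(1 / 2) : ℝ) * x ^ (ε / 4) = c ^ (-(1 / 2) : ℝ) * (x ^ (ε / 4))⁻¹ := by
      rw [Real.mul_rpow hc.le (by positivity), ← Real.rpow_mul hx0.le, mul_assoc,
        ← Real.rpow_add hx0, ← Real.rpow_neg hx0.le]
      ring_nf
    have h5 : (x / (q x : ℕ)) ^ (-(1 / 2) : ℝ) = (x / (q x : ℕ)) ^ (1 / 2 : ℝ) * ((q x : ℕ) / x) := by
      rw [← inv_div x, ← Real.rpow_neg_one, ← Real.rpow_add hX0]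
      norm_num
    calc _ ≤ (|K| * (x / (q x : ℕ)) ^ (1 / 2 : ℝ) * x ^ (ε / 4)) * ((q x : ℕ) * Real.log x / x) := by
          refine mul_le_mul (h1.trans ?_) (by gcongr) (by positivity) (by positivity)
          gcongr
          exact le_abs_self K
      _ = |K| * ((x / (q x : ℕ)) ^ (-(1 / 2) : ℝ) * x ^ (ε / 4)) * Real.log x := by
          rw [h5]
          ring
      _ ≤ |K| * ((c * x ^ ε) ^ (-(1 / 2) : ℝ) * x ^ (ε / 4)) * Real.log x := by gcongr
      _ = _ := by
          rw [h4]
          ring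
  simpa using hdiff.add tendsto_primeCounting_mul_log_div

end Asymptotics

end PrimeGen

namespace PrimeGen

section Asymptotics

variable {ε : ℝ} {q : ℝ → ℕ+}

theorem eventually_le_self (hε₀ : 0 < ε)
    (hq : (fun x : ℝ => ((q x : ℕ) : ℝ)) =Θ[atTop] fun x : ℝ => x ^ (1 - ε)) :
    ∀ᶠ x : ℝ in atTop, ((q x : ℕ) : ℝ) ≤ x := by
  filter_upwards [(tendsto_div_atTop hε₀ hq).eventually_ge_atTop 1] with x hx
  have hq0 : (0 : ℝ) < (q x : ℕ) := by exact_mod_cast (q x).pos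
  rwa [le_div_iff₀ hq0, one_mul] at hx

theorem totient_div_self_pos (n : ℕ+) : 0 < ((n : ℕ).totient : ℝ) / (n : ℕ) := by
  have hq0 : (0 : ℝ) < (n : ℕ) := by exact_mod_cast n.pos
  have hφ0 : (0 : ℝ) < (n : ℕ).totient := by exact_mod_cast Nat.totient_pos.2 n.pos
  positivity

/-- Since `φ(q) / q` is at least a constant times `(log x) ^ (-1/2)`, the product grows at least
like `√(log x)`. -/
theorem tendsto_totient_div_mul_log (hε₀ : 0 < ε)
    (hq : (fun x : ℝ => ((q x : ℕ) : ℝ)) =Θ[atTop] fun x : ℝ => x ^ (1 - ε)) :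
    Tendsto (fun x : ℝ => ((q x : ℕ).totient : ℝ) / (q x : ℕ) * Real.log x) atTop atTop := by
  have hl2 : 0 < Real.log 2 := Real.log_pos one_lt_two
  set D := 4 * (2 / Real.log 2 + 1)
  have hD : 0 < D := by positivity
  have hlim : Tendsto (fun x : ℝ => √(Real.log x / D)) atTop atTop :=
    Real.tendsto_sqrt_atTop.comp (Real.tendsto_log_atTop.atTop_div_const hD)
  refine tendsto_atTop_mono' _ ?_ hlim
  filter_upwards [eventually_le_self hε₀ hq, Real.tendsto_log_atTop.eventually_ge_atTop 1]
    with x hqx hl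
  have hq0 : (0 : ℝ) < (q x : ℕ) := by exact_mod_cast (q x).pos
  have h1 := one_le_totient_div_sq_mul (q x) (q x).pos
  have h2 := totient_div_self_pos (q x)
  have h3 : 4 * (2 * (Real.log (q x : ℕ) / Real.log 2) + 1) ≤ D * Real.log x := by
    have h4 : Real.log (q x : ℕ) / Real.log 2 ≤ Real.log x / Real.log 2 := by gcongr
    calc 4 * (2 * (Real.log (q x : ℕ) / Real.log 2) + 1)
        ≤ 4 * (2 * (Real.log x / Real.log 2) + Real.log x) := by gcongr
      _ = D * Real.log x := by ring
  refine Real.sqrt_le_iff.2 ⟨by positivity, ?_⟩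
  rw [div_le_iff₀ hD]
  have h5 := h1.trans (mul_le_mul_of_nonneg_left h3 (sq_nonneg _))
  have h6 := mul_le_mul_of_nonneg_left h5 (by linarith : 0 ≤ Real.log x)
  linarith

theorem eventually_primeCountingAP_pos (hFGM : FriedlanderGranvilleMontgomery) (hε₀ : 0 < ε)
    (hq : (fun x : ℝ => ((q x : ℕ) : ℝ)) =Θ[atTop] fun x : ℝ => x ^ (1 - ε))
    {a : ℝ → ℕ} (ha : ∀ x, a x ∈ unitReps (q x)) :
    ∀ᶠ x : ℝ in atTop, 0 < primeCountingAP x (q x) (a x) := by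
  filter_upwards [(tendsto_primeCountingAP hFGM hε₀ hq ha).eventually_const_lt zero_lt_one]
    with x hx
  refine Nat.pos_of_ne_zero fun h => ?_
  simp [h] at hx

theorem tendsto_expected_iterations (hFGM : FriedlanderGranvilleMontgomery) (hε₀ : 0 < ε)
    (hq : (fun x : ℝ => ((q x : ℕ) : ℝ)) =Θ[atTop] fun x : ℝ => x ^ (1 - ε))
    {a : ℝ → ℕ} (ha : ∀ x, a x ∈ unitReps (q x)) :
    Tendsto (fun x : ℝ => ((tRange x (q x) (a x)).card : ℝ) / primeCountingAP x (q x) (a x) /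
      (((q x : ℕ).totient : ℝ) / (q x : ℕ) * Real.log x)) atTop (𝓝 1) := by
  have h := (tendsto_card_tRange_div hε₀ hq ha).div (tendsto_primeCountingAP hFGM hε₀ hq ha)
    one_ne_zero
  rw [div_one] at h
  refine h.congr' ?_
  filter_upwards [eventually_gt_atTop 1, eventually_primeCountingAP_pos hFGM hε₀ hq ha]
    with x hx hk
  have hl := Real.log_pos hx
  have hq0 : (0 : ℝ) < (q x : ℕ) := by exact_mod_cast (q x).pos
  have hφ0 : (0 : ℝ) < (q x : ℕ).totient := by exact_mod_cast Nat.totient_pos.2 (q x).pos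
  have hk' : (0 : ℝ) < primeCountingAP x (q x) (a x) := by exact_mod_cast hk
  simp only [Pi.div_apply]
  field_simp

theorem tendsto_log_card_tRange_div_log (hε₀ : 0 < ε)
    (hq : (fun x : ℝ => ((q x : ℕ) : ℝ)) =Θ[atTop] fun x : ℝ => x ^ (1 - ε))
    {a : ℝ → ℕ} (ha : ∀ x, a x ∈ unitReps (q x)) :
    Tendsto (fun x : ℝ => Real.log (tRange x (q x) (a x)).card / Real.log x) atTop (𝓝 ε) := by
  have h1 := (tendsto_card_tRange_div hε₀ hq ha).log one_ne_zero
  rw [Real.log_one] at h1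
  have h2 := (h1.div_atTop Real.tendsto_log_atTop).add (tendsto_log_div_div_log hq)
  rw [zero_add] at h2
  refine h2.congr' ?_
  filter_upwards [(tendsto_div_atTop hε₀ hq).eventually_gt_atTop 0] with x hX
  have hN : (0 : ℝ) < (tRange x (q x) (a x)).card := by
    exact_mod_cast Finset.card_pos.2 (tRange_nonempty _ _ _)
  rw [← add_div, Real.log_div hN.ne' hX.ne', sub_add_cancel]

theorem card_unitReps (n : ℕ+) : (unitReps n).card = (n : ℕ).totient := rfl

theorem tendsto_expected_bits (hFGM : FriedlanderGranvilleMontgomery) (hε₀ : 0 < ε)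
    (hq : (fun x : ℝ => ((q x : ℕ) : ℝ)) =Θ[atTop] fun x : ℝ => x ^ (1 - ε))
    {a : ℝ → ℕ} (ha : ∀ x, a x ∈ unitReps (q x)) :
    Tendsto (fun x : ℝ => (Real.logb 2 (unitReps (q x)).card +
      ((tRange x (q x) (a x)).card : ℝ) / primeCountingAP x (q x) (a x) *
        Real.logb 2 (tRange x (q x) (a x)).card) /
      (((q x : ℕ).totient : ℝ) / (q x : ℕ) * (Real.log x ^ 2 / Real.log 2))) atTop (𝓝 ε) := by
  have hl2 : 0 < Real.log 2 := Real.log_pos one_lt_two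
  have h1 := (tendsto_expected_iterations hFGM hε₀ hq ha).mul
    (tendsto_log_card_tRange_div_log hε₀ hq ha)
  -- The share of the single draw of `a`: `log φ(q) ≤ log x`, so it is at most `1 / ((φ(q) / q) log
  -- x)`.
  have h2 : Tendsto (fun x : ℝ => Real.log (q x : ℕ).totient / Real.log x /
      (((q x : ℕ).totient : ℝ) / (q x : ℕ) * Real.log x)) atTop (𝓝 0) := by
    refine squeeze_zero' ?_ ?_ ((tendsto_totient_div_mul_log hε₀ hq).const_div_atTop 1)
    all_goals
      filter_upwards [eventually_gt_atTop 1, eventually_le_self hε₀ hq] with x hx hqx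
      have hl := Real.log_pos hx
      have hφ0 : (0 : ℝ) < (q x : ℕ).totient := by exact_mod_cast Nat.totient_pos.2 (q x).pos
      have hφq : ((q x : ℕ).totient : ℝ) ≤ (q x : ℕ) := by exact_mod_cast Nat.totient_le _
      have hp := totient_div_self_pos (q x)
    · have := Real.log_natCast_nonneg (q x : ℕ).totient
      positivity
    · gcongr
      rw [div_le_one hl]
      exact Real.log_le_log hφ0 (hφq.trans hqx)
  have h3 := h2.add h1
  rw [one_mul, zero_add] at h3
  refine h3.congr' ?_
  filter_upwards [eventually_gt_atTop 1] with x hx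
  have hl := Real.log_pos hx
  have hq0 : (0 : ℝ) < (q x : ℕ) := by exact_mod_cast (q x).pos
  have hφ0 : (0 : ℝ) < (q x : ℕ).totient := by exact_mod_cast Nat.totient_pos.2 (q x).pos
  rw [card_unitReps, Real.logb, Real.logb]
  field_simp

theorem inv_card_primeHits_div {x : ℝ} {n : ℕ+} (hqx : (n : ℝ) ≤ x) {a : ℕ} (ha : a ∈ unitReps n)
    (hk : 0 < primeCountingAP x n a) :
    ((primeHits x n a).card / (tRange x n a).card : ℝ≥0∞)⁻¹ =
      ENNReal.ofReal ((tRange x n a).card / primeCountingAP x n a) := by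
  have hk' : (0 : ℝ) < primeCountingAP x n a := by exact_mod_cast hk
  rw [card_primeHits hqx ha, ENNReal.inv_div (Or.inl (ENNReal.natCast_ne_top _))
    (Or.inl (by simpa using (tRange_nonempty x n a).ne_empty)), ENNReal.ofReal_div_of_pos hk',
    ENNReal.ofReal_natCast, ENNReal.ofReal_natCast]

theorem ofReal_mem_Icc_of_div_mem {r m c η : ℝ} (hm : 0 < m) (h : r / m ∈ Set.Icc (c - η) (c + η)) :
    ENNReal.ofReal r ∈
      Set.Icc (ENNReal.ofReal ((c - η) * m)) (ENNReal.ofReal ((c + η) * m)) :=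
  ⟨ENNReal.ofReal_le_ofReal ((le_div_iff₀ hm).1 h.1),
    ENNReal.ofReal_le_ofReal ((div_le_iff₀ hm).1 h.2)⟩

theorem eventually_lintegral_iterations_mem_Icc (hFGM : FriedlanderGranvilleMontgomery)
    (hε₀ : 0 < ε) (hq : (fun x : ℝ => ((q x : ℕ) : ℝ)) =Θ[atTop] fun x : ℝ => x ^ (1 - ε))
    {η : ℝ} (hη : 0 < η) :
    ∀ᶠ x : ℝ in atTop, ∫⁻ ω, (iterations (q x) ω : ℝ≥0∞) ∂(runLaw x (q x)) ∈
      Set.Icc (ENNReal.ofReal ((1 - η) * (((q x : ℕ).totient : ℝ) / (q x : ℕ) * Real.log x)))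
        (ENNReal.ofReal ((1 + η) * (((q x : ℕ).totient : ℝ) / (q x : ℕ) * Real.log x))) := by
  refine (eventually_forall_mem_of_forall_selector (fun x => unitReps_nonempty (q x))
    (P := fun x a => ∫⁻ t, (iterations (q x) (a, t) : ℝ≥0∞) ∂(loopLaw x (q x) a) ∈
      Set.Icc (ENNReal.ofReal ((1 - η) * (((q x : ℕ).totient : ℝ) / (q x : ℕ) * Real.log x)))
        (ENNReal.ofReal ((1 + η) * (((q x : ℕ).totient : ℝ) / (q x : ℕ) * Real.log x))))
    fun a ha => ?_).mono fun x hx => lintegral_runLaw_mem_Icc (measurable_iterations _) hx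
  filter_upwards [eventually_primeCountingAP_pos hFGM hε₀ hq ha, eventually_le_self hε₀ hq,
    (tendsto_expected_iterations hFGM hε₀ hq ha).eventually
      (Icc_mem_nhds (by linarith : 1 - η < 1) (by linarith : 1 < 1 + η)),
    (tendsto_totient_div_mul_log hε₀ hq).eventually_gt_atTop 0] with x hk hqx hx hm
  rw [lintegral_iterations_loopLaw, inv_card_primeHits_div hqx (ha x) hk]
  exact ofReal_mem_Icc_of_div_mem hm hx

theorem eventually_lintegral_randomBits_mem_Icc (hFGM : FriedlanderGranvilleMontgomery)
    (hε₀ : 0 < ε) (hq : (fun x : ℝ => ((q x : ℕ) : ℝ)) =Θ[atTop] fun x : ℝ => x ^ (1 - ε))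
    {η : ℝ} (hη : 0 < η) :
    ∀ᶠ x : ℝ in atTop, ∫⁻ ω, randomBits x (q x) ω ∂(runLaw x (q x)) ∈
      Set.Icc (ENNReal.ofReal ((ε - η) *
          (((q x : ℕ).totient : ℝ) / (q x : ℕ) * (Real.log x ^ 2 / Real.log 2))))
        (ENNReal.ofReal ((ε + η) *
          (((q x : ℕ).totient : ℝ) / (q x : ℕ) * (Real.log x ^ 2 / Real.log 2)))) := by
  refine (eventually_forall_mem_of_forall_selector (fun x => unitReps_nonempty (q x))
    (P := fun x a => ∫⁻ t, randomBits x (q x) (a, t) ∂(loopLaw x (q x) a) ∈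
      Set.Icc (ENNReal.ofReal ((ε - η) *
          (((q x : ℕ).totient : ℝ) / (q x : ℕ) * (Real.log x ^ 2 / Real.log 2))))
        (ENNReal.ofReal ((ε + η) *
          (((q x : ℕ).totient : ℝ) / (q x : ℕ) * (Real.log x ^ 2 / Real.log 2)))))
    fun a ha => ?_).mono fun x hx => lintegral_runLaw_mem_Icc (measurable_randomBits _ _) hx
  filter_upwards [eventually_primeCountingAP_pos hFGM hε₀ hq ha, eventually_le_self hε₀ hq,
    (tendsto_expected_bits hFGM hε₀ hq ha).eventually
      (Icc_mem_nhds (by linarith : ε - η < ε) (by linarith : ε < ε + η)),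
    eventually_gt_atTop 1] with x hk hqx hx hx1
  have hl := Real.log_pos hx1
  have hl2 : 0 < Real.log 2 := Real.log_pos one_lt_two
  have hp := totient_div_self_pos (q x)
  have hlog {n : ℕ} (hn : 0 < n) : 0 ≤ Real.logb 2 n :=
    Real.logb_nonneg one_lt_two (by exact_mod_cast hn)
  have h1 := hlog (Finset.card_pos.2 (unitReps_nonempty (q x)))
  have h2 := hlog (Finset.card_pos.2 (tRange_nonempty x (q x) (a x)))
  rw [lintegral_randomBits_loopLaw, inv_card_primeHits_div hqx (ha x) hk, drawBits, drawBits,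
    ← ENNReal.ofReal_mul (by positivity), ← ENNReal.ofReal_add h1 (by positivity)]
  exact ofReal_mem_Icc_of_div_mem (by positivity) hx

end Asymptotics

end PrimeGen

theorem mainTheorem8 (hFGM : PrimeGen.FriedlanderGranvilleMontgomery)
    (ε : ℝ) (hε₀ : 0 < ε) (hε₁ : ε < 1)
    (q : ℝ → ℕ+) (hq : (fun x : ℝ => ((q x : ℕ) : ℝ)) =Θ[atTop] fun x : ℝ => x ^ (1 - ε)) :
    (∀ᶠ x : ℝ in atTop, ∀ᵐ ω ∂(PrimeGen.runLaw x (q x)), PrimeGen.Terminates (q x) ω) ∧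
    (∃ δ : ℝ → ℝ, Tendsto δ atTop (𝓝 0) ∧ ∀ᶠ x : ℝ in atTop,
      ∫⁻ ω, (PrimeGen.iterations (q x) ω : ℝ≥0∞) ∂(PrimeGen.runLaw x (q x)) =
        ENNReal.ofReal
          ((1 + δ x) * ((Nat.totient (q x) : ℝ) / ((q x : ℕ) : ℝ)) * Real.log x)) ∧
    (∃ δ : ℝ → ℝ, Tendsto δ atTop (𝓝 0) ∧ ∀ᶠ x : ℝ in atTop,
      ∫⁻ ω, PrimeGen.randomBits x (q x) ω ∂(PrimeGen.runLaw x (q x)) =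
        ENNReal.ofReal
          ((ε + δ x) * ((Nat.totient (q x) : ℝ) / ((q x : ℕ) : ℝ)) *
            ((Real.log x) ^ 2 / Real.log 2))) := by
  refine ⟨?_, ?_, ?_⟩
  -- Any `η` would do: only finiteness of the expectation is used, as a run that never stops has
  -- `iterations` equal to `⊤`.
  · filter_upwards [PrimeGen.eventually_lintegral_iterations_mem_Icc hFGM hε₀ hq one_pos] with x hx
    have hfin := ne_top_of_le_ne_top ENNReal.ofReal_ne_top hx.2
    filter_upwards [ae_lt_top (PrimeGen.measurable_iterations _) hfin] with ω hω
    exact PrimeGen.terminates_of_iterations_lt_top hω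
  · simp_rw [mul_assoc]
    exact exists_tendsto_zero_eq_ofReal zero_le_one
      ((PrimeGen.tendsto_totient_div_mul_log hε₀ hq).eventually_gt_atTop 0)
      fun η hη => PrimeGen.eventually_lintegral_iterations_mem_Icc hFGM hε₀ hq hη
  · simp_rw [mul_assoc]
    refine exists_tendsto_zero_eq_ofReal hε₀.le ?_
      fun η hη => PrimeGen.eventually_lintegral_randomBits_mem_Icc hFGM hε₀ hq hη
    filter_upwards [eventually_gt_atTop 1] with x hx
    have hl := Real.log_pos hx
    have hl2 : 0 < Real.log 2 := Real.log_pos one_lt_two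
    have hp := PrimeGen.totient_div_self_pos (q x)
    positivity
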